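/- Let $\Omega\subset\mathbb R^d$, $d\ge 1$, be a bounded domain with Lipschitz boundary (locally the graph of a Lipschitz function, with $\Omega$ on one side), let $f,z\in L^2(\Omega)$, $\alpha,\beta>0$, $0<u_{\min}<u_{\max}$, and let $0=u_1<u_2<\dots<u_m=u_{\max}-u_{\min}$ with $m\ge 2$. Put $G(u)=\int_\Omega g(u(x))\,dx$, where $$g(t)=\begin{cases}-u_m t,& t\le u_1,\\ \tfrac12\big((u_i+u_{i+1})t-u_iu_{i+1}\big),& t\in[u_i,u_{i+1}],\ 1\le i<m,\\ u_m t-\tfrac12u_m^2,& t\ge u_m.\end{cases}$$ For $0\le\varepsilon<u_{\min}$ let $\Phi_\varepsilon(u)(x)=\phi_\varepsilon(u(x))$, where $$\phi_\varepsilon(t)=u_{\min}+\begin{cases}-\varepsilon,&t\le-\varepsilon,\\ -\frac{1}{\varepsilon^2}t^3-\frac1\varepsilon t^2+t,&t\in[-\varepsilon,0],\\ t,&t\in[0,u_m],\\ -\frac1{\varepsilon^2}t^3+\frac{3u_m+\varepsilon}{\varepsilon^2}t^2+\frac{\varepsilon^2-2u_m\varepsilon-3u_m^2}{\varepsilon^2}t+\frac{u_m^3+u_m^2\varepsilon}{\varepsilon^2},&t\in[u_m,u_m+\varepsilon],\\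 u_m+\varepsilon,&t\ge u_m+\varepsilon\end{cases}$$ (for $\varepsilon=0$: $\phi_0(t)$ is the projection of $t+u_{\min}$ onto $[u_{\min},u_{\max}]$). Consider the problem $$\text{(P)}\qquad\min_{u\in BV(\Omega)}\ \tfrac12\|y-z\|_{L^2(\Omega)}^2+\alpha\,G(u)+\beta\,\mathrm{TV}(u)\quad\text{s.t.}\quad -\operatorname{div}(\Phi_\varepsilon(u)\nabla y)=f\ \text{in }\Omega,\quad y=0\ \text{on }\partial\Omega,$$ where $y\in H^1_0(\Omega)$ is the weak solution and $\mathrm{TV}$ is the isotropic total variation. Local solutions are understood with respect to the norm $\|u\|_{L^1(\Omega)}+\mathrm{TV}(u)$ of $BV(\Omega)$. Let $$U_\varepsilon=\{v\in L^\infty(\Omega):\ 0<u_{\min}-\varepsilon\le v\le u_{\max}+\varepsilon\ \text{a.e. in }\Omega\}.$$ 1. For every $0\le\varepsilon<u_{\min}$, every local solution $\bar u\in BV(\Omega)$ of (P) satisfies $\bar u+u_{\min}\in U_\varepsilon$, i.e. $-\varepsilon\le\bar u\le u_m+\varepsilon$ almost everywhere in $\Omega$. In particular $\bar u\in L^\infty(\Omega)$.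 2. For $\varepsilon=0$, every local solution of (P) is a local solution of the box-constrained problem $$\text{(P}^*)\qquad\min_{u\in BV(\Omega)}\ \tfrac12\|y-z\|_{L^2(\Omega)}^2+\alpha\,G(u)+\beta\,\mathrm{TV}(u)\quad\text{s.t.}\quad u+u_{\min}\in[u_{\min},u_{\max}]\ \text{a.e.},\quad -\operatorname{div}((u+u_{\min})\nabla y)=f\ \text{in }\Omega,\quad y=0\ \text{on }\partial\Omega,$$ and the (global) solutions of (P) coincide with the (global) solutions of (P$^*$). -/

import Mathlib

open MeasureTheory Set Filter Topology
open scoped ENNReal NNReal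

noncomputable section

/-- Euclidean space `ℝᵈ`, with the Euclidean norm. -/
abbrev Euc (d : ℕ) : Type := EuclideanSpace ℝ (Fin d)

/-! ### Lipschitz boundary -/

/-- The first `n` coordinates `x_{-,d}` of `x ∈ ℝⁿ⁺¹` (so `d = n + 1`) in the Euclidean coordinate
system (orthonormal basis) `b`. -/
def headCoords {n : ℕ} (b : OrthonormalBasis (Fin (n + 1)) ℝ (Euc (n + 1))) (x : Euc (n + 1)) :
    Euc n :=
  WithLp.toLp 2 (fun i : Fin n => b.repr x i.castSucc)

/-- The last coordinate `x_d` of `x ∈ ℝⁿ⁺¹` in the Euclidean coordinate system `b`. -/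
def lastCoord {n : ℕ} (b : OrthonormalBasis (Fin (n + 1)) ℝ (Euc (n + 1))) (x : Euc (n + 1)) : ℝ :=
  b.repr x (Fin.last n)

/-- `Ω` has a Lipschitz boundary: `∂Ω` is covered by finitely many cylinders in each of which, in
suitable Euclidean coordinates, `∂Ω` is a Lipschitz graph, `Ω` lies above the graph and the
complement of `Ω` lies below it. -/
def HasLipschitzBoundary {n : ℕ} (Ω : Set (Euc (n + 1))) : Prop :=
  ∃ (l : ℕ) (U : Fin l → Set (Euc (n + 1))),
    frontier Ω ⊆ ⋃ j, U j ∧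
    ∀ j, IsOpen (U j) ∧
      ∃ (b : OrthonormalBasis (Fin (n + 1)) ℝ (Euc (n + 1))) (y : Euc n) (r h : ℝ)
        (η : Euc n → ℝ) (K : ℝ≥0),
        0 < r ∧ 0 < h ∧ LipschitzWith K η ∧
        U j = {x | ‖headCoords b x - y‖ < r ∧ |lastCoord b x - η (headCoords b x)| < h} ∧
        (∀ x ∈ U j, lastCoord b x = η (headCoords b x) → x ∈ frontier Ω) ∧
        (∀ x ∈ U j, 0 < lastCoord b x - η (headCoords b x) →
          lastCoord b x - η (headCoords b x) < h → x ∈ Ω) ∧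
        (∀ x ∈ U j, lastCoord b x - η (headCoords b x) < 0 →
          -h < lastCoord b x - η (headCoords b x) → x ∉ Ω)

/-! ### Functions of bounded variation

Functions on `Ω` are represented by functions on `ℝᵈ`; only their values almost everywhere in `Ω`
matter in all definitions below. -/

/-- The divergence of a vector field. -/
def divergence {d : ℕ} (Ψ : Euc d → Euc d) (x : Euc d) : ℝ :=
  ∑ i : Fin d, (fderiv ℝ Ψ x (EuclideanSpace.single i 1)) i

/-- `ψ ∈ C_c^∞(Ω; F)`. -/
def IsTestFunction {d : ℕ} {F : Type} [NormedAddCommGroup F] [NormedSpace ℝ F]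
    (Ω : Set (Euc d)) (ψ : Euc d → F) : Prop :=
  ContDiff ℝ ((⊤ : ℕ∞) : WithTop ℕ∞) ψ ∧ HasCompactSupport ψ ∧ tsupport ψ ⊆ Ω

/-- The (isotropic) total variation of `v ∈ L¹(Ω)`, i.e. the norm of the distributional derivative
`Dv`: the supremum of `∫_Ω v div Ψ` over all `Ψ ∈ C_c^∞(Ω; ℝᵈ)` with `|Ψ|₂ ≤ 1`
(it is `∞` if `Dv` is not a finite Radon measure). -/
def totalVariation {d : ℕ} (Ω : Set (Euc d)) (v : Euc d → ℝ) : ℝ≥0∞ :=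
  ⨆ (Ψ : Euc d → Euc d) (_ : IsTestFunction Ω Ψ ∧ ∀ x, ‖Ψ x‖ ≤ 1),
    ENNReal.ofReal (∫ x in Ω, v x * divergence Ψ x)

/-- `v ∈ BV(Ω)`. -/
def MemBV {d : ℕ} (Ω : Set (Euc d)) (v : Euc d → ℝ) : Prop :=
  MemLp v 1 (volume.restrict Ω) ∧ totalVariation Ω v < ⊤

/-- The norm `‖v‖_{BV(Ω)} = ‖v‖_{L¹(Ω)} + TV(v)`. -/
def bvNorm {d : ℕ} (Ω : Set (Euc d)) (v : Euc d → ℝ) : ℝ≥0∞ :=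
  eLpNorm v 1 (volume.restrict Ω) + totalVariation Ω v

/-! ### Weak solutions of the Dirichlet problem -/

/-- `V` is the weak gradient of `y` in `Ω`. -/
def IsWeakGradient {d : ℕ} (Ω : Set (Euc d)) (y : Euc d → ℝ) (V : Euc d → Euc d) : Prop :=
  ∀ ψ : Euc d → ℝ, IsTestFunction Ω ψ → ∀ i : Fin d,
    ∫ x in Ω, y x * fderiv ℝ ψ x (EuclideanSpace.single i 1) = -∫ x in Ω, V x i * ψ x

/-- `y ∈ H¹₀(Ω)` with weak gradient `V`; here `H¹₀(Ω)` is the closure of `C_c^∞(Ω)` in `H¹(Ω)`. -/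
def MemH10 {d : ℕ} (Ω : Set (Euc d)) (y : Euc d → ℝ) (V : Euc d → Euc d) : Prop :=
  MemLp y 2 (volume.restrict Ω) ∧ MemLp V 2 (volume.restrict Ω) ∧ IsWeakGradient Ω y V ∧
    ∃ ψ : ℕ → Euc d → ℝ, (∀ k, IsTestFunction Ω (ψ k)) ∧
      Tendsto (fun k => eLpNorm (fun x => ψ k x - y x) 2 (volume.restrict Ω)) atTop (𝓝 0) ∧
      Tendsto (fun k => eLpNorm (fun x => gradient (ψ k) x - V x) 2 (volume.restrict Ω))
        atTop (𝓝 0)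

/-- `y ∈ H¹₀(Ω)` is a weak solution of `-div (w ∇y) = f` in `Ω`, `y = 0` on `∂Ω`. -/
def IsWeakSolution {d : ℕ} (Ω : Set (Euc d)) (w f y : Euc d → ℝ) : Prop :=
  ∃ V : Euc d → Euc d, MemH10 Ω y V ∧
    ∀ ψ : Euc d → ℝ, IsTestFunction Ω ψ →
      ∫ x in Ω, w x * inner ℝ (V x) (gradient ψ x) = ∫ x in Ω, f x * ψ x

/-! ### The optimization problems -/

/-- The data of the problem, in dimension `d = n + 1`: a bounded open set `Ω` with Lipschitz
boundary, the desired values `u₁ < ⋯ < u_m` (`m ≥ 2`) with `u₁ = 0` and `u_m = u_max - u_min`,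
where `u_min > 0`, weights `α, β > 0`, and `f, z ∈ L²(Ω)`. -/
structure MultibangData (n : ℕ) where
  Ω : Set (Euc (n + 1))
  isOpen : IsOpen Ω
  isBounded : Bornology.IsBounded Ω
  lipschitz : HasLipschitzBoundary Ω
  m : ℕ
  two_le_m : 2 ≤ m
  val : ℕ → ℝ
  val_strictMono : StrictMonoOn val (Icc 1 m)
  umin : ℝ
  umax : ℝ
  umin_pos : 0 < umin
  val_one : val 1 = 0
  val_m : val m = umax - umin
  α : ℝ
  α_pos : 0 < α
  β : ℝ
  β_pos : 0 < β
  f : Euc (n + 1) → ℝ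
  f_mem : MemLp f 2 (volume.restrict Ω)
  z : Euc (n + 1) → ℝ
  z_mem : MemLp z 2 (volume.restrict Ω)

namespace MultibangData

variable {n : ℕ} (D : MultibangData n)

/-- The largest desired value `u_m`. -/
def um : ℝ := D.val D.m

/-- The pointwise multi-bang integrand `g`. The middle case is `½((uᵢ + uᵢ₊₁) t - uᵢ uᵢ₊₁)` for the
one index `1 ≤ i < m` with `uᵢ < t ≤ uᵢ₊₁`. -/
def g (t : ℝ) : ℝ :=
  if t ≤ D.val 1 then -D.um * t
  else if D.um < t then D.um * t - 1 / 2 * D.um ^ 2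
  else ∑ i ∈ Finset.Ico 1 D.m,
    (Ioc (D.val i) (D.val (i + 1))).indicator
      (fun s => 1 / 2 * ((D.val i + D.val (i + 1)) * s - D.val i * D.val (i + 1))) t

/-- The multi-bang penalty `G(u) = ∫_Ω g(u(x)) dx`. -/
def G (u : Euc (n + 1) → ℝ) : ℝ := ∫ x in D.Ω, D.g (u x)

/-- The smoothed pointwise projection `φ_ε` onto `[u_min, u_max]`. For `ε = 0` the two cubic
branches are never reached and this is the projection itself. -/
def phi (ε t : ℝ) : ℝ :=
  D.umin +
    if t ≤ -ε then -ε
    else if t ≤ 0 then -(1 / ε ^ 2) * t ^ 3 - 1 / ε * t ^ 2 + t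
    else if t ≤ D.um then t
    else if t ≤ D.um + ε then
      -(1 / ε ^ 2) * t ^ 3 + (3 * D.um + ε) / ε ^ 2 * t ^ 2
        + (ε ^ 2 - 2 * D.um * ε - 3 * D.um ^ 2) / ε ^ 2 * t
        + (D.um ^ 3 + D.um ^ 2 * ε) / ε ^ 2
    else D.um + ε

/-- `U_ε = {v ∈ L^∞(Ω) : 0 < u_min - ε ≤ v ≤ u_max + ε a.e. in Ω}`. -/
def U (ε : ℝ) : Set (Euc (n + 1) → ℝ) :=
  {v | MemLp v ⊤ (volume.restrict D.Ω) ∧ 0 < D.umin - ε ∧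
    ∀ᵐ x ∂(volume.restrict D.Ω), D.umin - ε ≤ v x ∧ v x ≤ D.umax + ε}

/-- The objective `½ ‖y - z‖²_{L²(Ω)} + α G(u) + β TV(u)`, for `u ∈ BV(Ω)`. -/
def cost (u y : Euc (n + 1) → ℝ) : ℝ :=
  1 / 2 * (∫ x in D.Ω, (y x - D.z x) ^ 2) + D.α * D.G u + D.β * (totalVariation D.Ω u).toReal

/-- `(u, y)` satisfies the constraints of (P): `u ∈ BV(Ω)` and `-div (Φ_ε(u) ∇y) = f` in `Ω`,
`y = 0` on `∂Ω`. -/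
def FeasibleP (ε : ℝ) (u y : Euc (n + 1) → ℝ) : Prop :=
  MemBV D.Ω u ∧ IsWeakSolution D.Ω (fun x => D.phi ε (u x)) D.f y

/-- `(u, y)` satisfies the constraints of (P*): `u ∈ BV(Ω)`, `u + u_min ∈ [u_min, u_max]` a.e. and
`-div ((u + u_min) ∇y) = f` in `Ω`, `y = 0` on `∂Ω`. -/
def FeasibleStar (u y : Euc (n + 1) → ℝ) : Prop :=
  MemBV D.Ω u ∧
    (∀ᵐ x ∂(volume.restrict D.Ω), u x + D.umin ∈ Icc D.umin D.umax) ∧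
    IsWeakSolution D.Ω (fun x => u x + D.umin) D.f y

/-- `u`, with its state `y`, is a global solution of the problem with the given constraints. -/
def IsGlobalSolution (Feasible : (Euc (n + 1) → ℝ) → (Euc (n + 1) → ℝ) → Prop)
    (u : Euc (n + 1) → ℝ) : Prop :=
  ∃ y, Feasible u y ∧ ∀ v w, Feasible v w → D.cost u y ≤ D.cost v w

/-- `u`, with its state `y`, is a local solution of the problem with the given constraints: it is
optimal among all feasible controls `v` in some `BV(Ω)`-ball around `u`. -/
def IsLocalSolution (Feasible : (Euc (n + 1) → ℝ) → (Euc (n + 1) → ℝ) → Prop)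
    (u : Euc (n + 1) → ℝ) : Prop :=
  ∃ y, Feasible u y ∧ ∃ δ : ℝ, 0 < δ ∧ ∀ v w, Feasible v w →
    bvNorm D.Ω (fun x => v x - u x) < ENNReal.ofReal δ → D.cost u y ≤ D.cost v w

end MultibangData

end

/-!
A local solution `u` of (P) is compared with the controls `v = u + s (ũ - u)`, `0 < s < 1`, where
`ũ` is the pointwise projection of `u` onto `[-ε, u_m + ε]`. Where `u` lies in this interval nothing
changes. Where it does not, `v` lies on the same side of the interval as `u`, a region on which
`φ_ε` is constant and `g` is affine with slope `± u_m ≠ 0`. Hence `u` and `v` have the same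
coefficient and the same state (`phi_shrink`), while `g(v) < g(u)` wherever `ũ ≠ u`
(`g_shrink_lt`). Moreover `‖v - u‖_{BV} = s ‖ũ - u‖_{BV}` is small for small `s`, and
`TV(v) ≤ TV(u)`. Local optimality of `u` then forces `G(u) ≤ G(v)`, so `ũ = u` almost everywhere
(`ae_mem_of_isLocalSolution`).

For `ε = 0` this places every local solution of (P) in the feasible set of (P*). On that set both
problems have the same states and costs, which gives the assertion on local solutions and one half
of the assertion on global solutions. For the other half, projecting any feasible control of (P)
onto `[0, u_m]` gives a feasible control of (P*) with the same state and no larger cost.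

The analytic core is `TV(ũ) ≤ TV(u)`; it is proved for `T ∘ u` with any bounded `1`-Lipschitz `T`
(`totalVariation_comp_le`), directly from the dual definition of `TV`. Let `Ψ` be an admissible
test field, let `w = ρ ⋆ u` be a mollification, and let `T` first be smooth. The field
`(T(w) - w T'(w)) Ψ` has compact support and divergence `T(w) div Ψ - w div (T'(w) Ψ)`, hence
`∫ T(w) div Ψ = ∫ w div (T'(w) Ψ) = ∫ u div (ρ ⋆ (T'(w) Ψ))`.
Since `|T'| ≤ 1`, the field `ρ ⋆ (T'(w) Ψ)` is admissible once the support of `ρ` is small compared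
with the distance from `supp Ψ` to `∂Ω`, and the right-hand side is at most `TV(u)`. Mollifying `T`
as well and letting both mollification parameters tend to zero gives the claim by dominated
convergence. The argument is local in `Ω`, so no regularity of `∂Ω` enters.
-/

noncomputable section

open scoped Convolution

variable {d : ℕ}

/-! ### Divergence of smooth fields -/

/-- The trace of an endomorphism of `ℝᵈ`, so that `div Ψ = trace (fderiv Ψ)`. -/
def traceCLM (d : ℕ) : (Euc d →L[ℝ] Euc d) →L[ℝ] ℝ :=
  ∑ i : Fin d, (EuclideanSpace.proj i).comp
    (ContinuousLinearMap.apply ℝ (Euc d) (EuclideanSpace.single i (1 : ℝ)))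

theorem traceCLM_apply (A : Euc d →L[ℝ] Euc d) :
    traceCLM d A = ∑ i : Fin d, (A (EuclideanSpace.single i 1)) i := by
  simp [traceCLM]

theorem divergence_eq_traceCLM (Ψ : Euc d → Euc d) (x : Euc d) :
    divergence Ψ x = traceCLM d (fderiv ℝ Ψ x) := by
  rw [traceCLM_apply]; rfl

theorem continuous_divergence {Ψ : Euc d → Euc d} (h : ContDiff ℝ 1 Ψ) :
    Continuous (divergence Ψ) := by
  have : divergence Ψ = fun x => traceCLM d (fderiv ℝ Ψ x) :=
    funext fun x => divergence_eq_traceCLM Ψ x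
  rw [this]
  exact (traceCLM d).continuous.comp (h.continuous_fderiv one_ne_zero)

theorem divergence_eq_zero_of_notMem_tsupport {Ψ : Euc d → Euc d} {x : Euc d}
    (hx : x ∉ tsupport Ψ) : divergence Ψ x = 0 := by
  rw [divergence_eq_traceCLM,
    image_eq_zero_of_notMem_tsupport (fun h => hx (tsupport_fderiv_subset ℝ h)), map_zero]

theorem hasCompactSupport_divergence {Ψ : Euc d → Euc d} (h : HasCompactSupport Ψ) :
    HasCompactSupport (divergence Ψ) :=
  HasCompactSupport.intro h fun _ hx => divergence_eq_zero_of_notMem_tsupport hx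

theorem integrable_divergence {Ψ : Euc d → Euc d} (h : ContDiff ℝ 1 Ψ)
    (hc : HasCompactSupport Ψ) : Integrable (divergence Ψ) :=
  (continuous_divergence h).integrable_of_hasCompactSupport (hasCompactSupport_divergence hc)

theorem integral_divergence_eq_zero {Ψ : Euc d → Euc d} (h : ContDiff ℝ 1 Ψ)
    (hc : HasCompactSupport Ψ) : ∫ x, divergence Ψ x = 0 := by
  have hI : Integrable (fderiv ℝ Ψ) :=
    (h.continuous_fderiv one_ne_zero).integrable_of_hasCompactSupport (hc.fderiv ℝ)
  have key : ∀ e : Euc d, ∫ x, fderiv ℝ Ψ x e = 0 := by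
    intro e
    have hI' : Integrable fun x => fderiv ℝ Ψ x e := hI.apply_continuousLinearMap e
    have := integral_smul_fderiv_eq_neg_fderiv_smul_of_integrable (μ := volume) (v := e)
      (f := fun _ : Euc d => (1 : ℝ)) (g := Ψ) (by simp) (by simpa using hI')
      (by simpa using h.continuous.integrable_of_hasCompactSupport hc)
      (fun _ _ => differentiableAt_const _) (fun x _ => h.differentiable one_ne_zero x)
    simpa using this
  simp_rw [divergence_eq_traceCLM]
  rw [(traceCLM d).integral_comp_comm hI, traceCLM_apply]
  refine Finset.sum_eq_zero fun i _ => ?_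
  rw [ContinuousLinearMap.integral_apply hI, key]; rfl

theorem divergence_smul {a : Euc d → ℝ} {Ψ : Euc d → Euc d} {x : Euc d}
    (ha : DifferentiableAt ℝ a x) (h : DifferentiableAt ℝ Ψ x) :
    divergence (fun y => a y • Ψ y) x = a x * divergence Ψ x + fderiv ℝ a x (Ψ x) := by
  have hx : fderiv ℝ a x (Ψ x) = ∑ i, fderiv ℝ a x (EuclideanSpace.single i 1) * Ψ x i := by
    conv_lhs => rw [← (EuclideanSpace.basisFun (Fin d) ℝ).sum_repr (Ψ x)]
    simp [mul_comm]
  have := fderiv_fun_smul ha h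
  rw [hx]
  simp only [divergence, this, Finset.mul_sum, ← Finset.sum_add_distrib]
  simp

theorem divergence_sub {Ψ₁ Ψ₂ : Euc d → Euc d} {x : Euc d}
    (h₁ : DifferentiableAt ℝ Ψ₁ x) (h₂ : DifferentiableAt ℝ Ψ₂ x) :
    divergence (fun y => Ψ₁ y - Ψ₂ y) x = divergence Ψ₁ x - divergence Ψ₂ x := by
  simp only [divergence_eq_traceCLM, fderiv_fun_sub h₁ h₂, map_sub]

theorem HasCompactSupport.fun_smul {a : Euc d → ℝ} {Ψ : Euc d → Euc d}
    (hc : HasCompactSupport Ψ) : HasCompactSupport fun y => a y • Ψ y :=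
  HasCompactSupport.intro hc fun x hx => by
    rw [image_eq_zero_of_notMem_tsupport hx, smul_zero]

/-- The cancellation behind the chain rule: the field `(T(w) - w T'(w)) Ψ` has divergence
`T(w) div Ψ - w div (T'(w) Ψ)`, because the terms with `∇w` drop out. -/
theorem integral_comp_mul_divergence {T : ℝ → ℝ} {w : Euc d → ℝ} {Ψ : Euc d → Euc d}
    (hT : ContDiff ℝ 2 T) (hw : ContDiff ℝ 1 w) (h : ContDiff ℝ 1 Ψ)
    (hc : HasCompactSupport Ψ) :
    ∫ x, T (w x) * divergence Ψ x =
      ∫ x, w x * divergence (fun y => deriv T (w y) • Ψ y) x := by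
  have hT1 : ContDiff ℝ 1 T := hT.of_le (by norm_num)
  have hT' : ContDiff ℝ 1 (deriv T) := by
    have : ContDiff ℝ (1 + 1) T := by simpa [one_add_one_eq_two] using hT
    exact (contDiff_succ_iff_deriv.1 this).2.2
  have hTw : ContDiff ℝ 1 fun x => T (w x) := hT1.comp hw
  have hT'w : ContDiff ℝ 1 fun x => deriv T (w x) := hT'.comp hw
  have hΨ' : ContDiff ℝ 1 fun y => deriv T (w y) • Ψ y := hT'w.smul h
  have hc' : HasCompactSupport fun y => deriv T (w y) • Ψ y := hc.fun_smul
  have c1 : ContDiff ℝ 1 fun y => T (w y) • Ψ y := hTw.smul h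
  have c2 : ContDiff ℝ 1 fun y => w y • (deriv T (w y) • Ψ y) := hw.smul hΨ'
  have s1 : HasCompactSupport fun y => T (w y) • Ψ y := hc.fun_smul
  have s2 : HasCompactSupport fun y => w y • (deriv T (w y) • Ψ y) := hc'.fun_smul
  have h0 : ∫ x, divergence (fun y => (T (w y) • Ψ y) - w y • (deriv T (w y) • Ψ y)) x = 0 :=
    integral_divergence_eq_zero (c1.sub c2) (s1.sub s2)
  have h1 : ∀ x, divergence (fun y => (T (w y) • Ψ y) - w y • (deriv T (w y) • Ψ y)) x =
      T (w x) * divergence Ψ x - w x * divergence (fun y => deriv T (w y) • Ψ y) x := by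
    intro x
    have d1 := hTw.differentiable one_ne_zero x
    have d2 := h.differentiable one_ne_zero x
    have d3 := hw.differentiable one_ne_zero x
    have d4 := hΨ'.differentiable one_ne_zero x
    have e1 : fderiv ℝ (fun y => T (w y)) x = deriv T (w x) • fderiv ℝ w x :=
      ((hT1.differentiable one_ne_zero (w x)).hasDerivAt.comp_hasFDerivAt x d3.hasFDerivAt).fderiv
    rw [divergence_sub (d1.fun_smul d2) (d3.fun_smul d4), divergence_smul d1 d2, divergence_smul d3 d4, e1]
    simp
  simp_rw [h1] at h0
  rw [integral_sub] at h0
  · linarith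
  · exact (hTw.continuous.mul (continuous_divergence h)).integrable_of_hasCompactSupport
      (hasCompactSupport_divergence hc).mul_left
  · exact (hw.continuous.mul (continuous_divergence hΨ')).integrable_of_hasCompactSupport
      (hasCompactSupport_divergence hc').mul_left

/-! ### Mollification -/

section Mollification

variable {E F : Type*} [NormedAddCommGroup E] [InnerProductSpace ℝ E] [FiniteDimensional ℝ E]
  [MeasurableSpace E] [BorelSpace E] [NormedAddCommGroup F] [NormedSpace ℝ F]

/-- The mollification `ρ ⋆ v` of `v` with the normalized bump function `ρ`. -/
def mollify (ρ : ContDiffBump (0 : E)) (v : E → F) : E → F :=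
  ρ.normed volume ⋆[ContinuousLinearMap.lsmul ℝ ℝ, volume] v

theorem mollify_apply (ρ : ContDiffBump (0 : E)) (v : E → F) (x : E) :
    mollify ρ v x = ∫ t, ρ.normed volume t • v (x - t) := rfl

theorem contDiff_mollify (ρ : ContDiffBump (0 : E)) {v : E → F} (hv : LocallyIntegrable v)
    [CompleteSpace F] {k : ℕ∞} : ContDiff ℝ k (mollify ρ v) :=
  ρ.hasCompactSupport_normed.contDiff_convolution_left _ ρ.contDiff_normed hv

theorem norm_mollify_le (ρ : ContDiffBump (0 : E)) {v : E → F} {C : ℝ}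
    (hC : ∀ x, ‖v x‖ ≤ C) (x : E) : ‖mollify ρ v x‖ ≤ C := by
  rw [mollify_apply]
  have h := norm_integral_le_of_norm_le (μ := volume) (f := fun t => ρ.normed volume t • v (x - t))
    (ρ.integrable_normed.mul_const C)
    (Eventually.of_forall fun t => by
      rw [norm_smul, Real.norm_of_nonneg (ρ.nonneg_normed t)]
      exact mul_le_mul_of_nonneg_left (hC _) (ρ.nonneg_normed t))
  rwa [integral_mul_const, ρ.integral_normed, one_mul] at h

theorem ContDiffBump.integrable_normed_smul_comp_sub (ρ : ContDiffBump (0 : E)) {v : E → F}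
    (hv : Continuous v) (x : E) : Integrable fun t => ρ.normed volume t • v (x - t) := by
  have hc : Continuous fun t => ρ.normed volume t • v (x - t) :=
    ρ.continuous_normed.smul (hv.comp (continuous_const.sub continuous_id))
  refine hc.integrable_of_hasCompactSupport
    (HasCompactSupport.intro (ρ.hasCompactSupport_normed (μ := volume)) fun t ht => ?_)
  rw [image_eq_zero_of_notMem_tsupport ht, zero_smul]

theorem mollify_sub_apply (ρ : ContDiffBump (0 : E)) {v : E → F} (hv : Continuous v) (x y : E) :
    mollify ρ v x - mollify ρ v y = ∫ t, ρ.normed volume t • (v (x - t) - v (y - t)) := by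
  have hi := ρ.integrable_normed_smul_comp_sub hv
  rw [mollify_apply, mollify_apply, ← integral_sub (hi x) (hi y)]
  simp_rw [smul_sub]

theorem LipschitzWith.mollify (ρ : ContDiffBump (0 : E)) {v : E → F} {K : ℝ≥0}
    (hv : LipschitzWith K v) : LipschitzWith K (mollify ρ v) := by
  refine LipschitzWith.of_dist_le_mul fun x y => ?_
  rw [dist_eq_norm, mollify_sub_apply ρ hv.continuous]
  have h := norm_integral_le_of_norm_le (μ := volume)
    (f := fun t => ρ.normed volume t • (v (x - t) - v (y - t)))
    (ρ.integrable_normed.mul_const (K * dist x y))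
    (Eventually.of_forall fun t => by
      rw [norm_smul, Real.norm_of_nonneg (ρ.nonneg_normed t), ← dist_eq_norm]
      refine mul_le_mul_of_nonneg_left ?_ (ρ.nonneg_normed t)
      simpa using hv.dist_le_mul (x - t) (y - t))
  rwa [integral_mul_const, ρ.integral_normed, one_mul] at h

theorem dist_mollify_le_of_lipschitz [CompleteSpace F] (ρ : ContDiffBump (0 : E)) {v : E → F}
    (hv : LipschitzWith 1 v) (x : E) : dist (mollify ρ v x) (v x) ≤ ρ.rOut :=
  ρ.dist_normed_convolution_le hv.continuous.aestronglyMeasurable fun y hy => by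
    have := hv.dist_le_mul y x
    rw [NNReal.coe_one, one_mul] at this
    exact this.trans (Metric.mem_ball.1 hy).le

theorem tsupport_mollify_subset (ρ : ContDiffBump (0 : E)) (v : E → F) :
    tsupport (mollify ρ v) ⊆ Metric.cthickening ρ.rOut (tsupport v) := by
  refine closure_minimal ?_ Metric.isClosed_cthickening
  refine (support_convolution_subset_swap _).trans ?_
  rintro _ ⟨a, ha, b, hb, rfl⟩
  rw [ρ.support_normed_eq] at hb
  refine Metric.mem_cthickening_of_dist_le _ a _ _ (subset_tsupport v ha) ?_
  simpa using (Metric.mem_ball.1 hb).le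

theorem HasCompactSupport.mollify (ρ : ContDiffBump (0 : E)) {v : E → F}
    (hv : HasCompactSupport v) : HasCompactSupport (mollify ρ v) :=
  hv.isCompact.cthickening.of_isClosed_subset (isClosed_tsupport _) (tsupport_mollify_subset ρ v)

/-- Mollification is symmetric for the `L²` pairing, since bump functions are even. -/
theorem integral_mollify_mul (ρ : ContDiffBump (0 : E)) {v φ : E → ℝ} (hv : Integrable v)
    (hφ : Integrable φ) :
    ∫ x, mollify ρ v x * φ x = ∫ x, v x * mollify ρ φ x := by
  have hswap : ∀ (w : E → ℝ) x, mollify ρ w x = ∫ t, ρ.normed volume (x - t) * w t := by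
    intro w x
    exact convolution_eq_swap _
  obtain ⟨C, hC⟩ := ρ.continuous_normed (μ := volume) |>.bounded_above_of_compact_support
    ρ.hasCompactSupport_normed
  have hint : Integrable (fun p : E × E => ρ.normed volume (p.1 - p.2) * (φ p.1 * v p.2))
      (volume.prod volume) :=
    (hφ.mul_prod hv).bdd_mul
      (ρ.continuous_normed.comp (continuous_fst.sub continuous_snd)).aestronglyMeasurable
      (Eventually.of_forall fun p => hC _)
  calc ∫ x, mollify ρ v x * φ x
      = ∫ x, ∫ t, ρ.normed volume (x - t) * (φ x * v t) := by
        congr 1; ext x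
        rw [hswap, ← integral_mul_const]
        congr 1; ext t; ring
    _ = ∫ t, ∫ x, ρ.normed volume (x - t) * (φ x * v t) := integral_integral_swap hint
    _ = ∫ x, v x * mollify ρ φ x := by
        congr 1; ext t
        rw [hswap, ← integral_const_mul]
        congr 1; ext x
        rw [← neg_sub t x, ρ.normed_neg]; ring

end Mollification

/-! ### Total variation under composition with Lipschitz functions -/

theorem divergence_mollify (ρ : ContDiffBump (0 : Euc d)) {Ψ : Euc d → Euc d}
    (h : ContDiff ℝ 1 Ψ) (hc : HasCompactSupport Ψ) :
    divergence (mollify ρ Ψ) = mollify ρ (divergence Ψ) := by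
  ext x
  have h1 : fderiv ℝ (mollify ρ Ψ) x = ∫ t, ρ.normed volume t • fderiv ℝ Ψ (x - t) :=
    (hc.hasFDerivAt_convolution_right (ContinuousLinearMap.lsmul ℝ ℝ)
      (ρ.continuous_normed (μ := volume)).locallyIntegrable h x).fderiv
  have hi := ρ.integrable_normed_smul_comp_sub (h.continuous_fderiv one_ne_zero) x
  rw [divergence_eq_traceCLM, h1, ← (traceCLM d).integral_comp_comm hi, mollify_apply]
  simp_rw [map_smul, divergence_eq_traceCLM]

theorem setIntegral_mul_divergence_eq {Ω : Set (Euc d)} (v : Euc d → ℝ) {Ψ : Euc d → Euc d}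
    (hΨ : tsupport Ψ ⊆ Ω) :
    ∫ x in Ω, v x * divergence Ψ x = ∫ x, v x * divergence Ψ x :=
  setIntegral_eq_integral_of_forall_compl_eq_zero fun x hx => by
    rw [divergence_eq_zero_of_notMem_tsupport fun h => hx (hΨ h), mul_zero]

theorem IsTestFunction.contDiff_one {F : Type} [NormedAddCommGroup F] [NormedSpace ℝ F]
    {Ω : Set (Euc d)} {ψ : Euc d → F} (h : IsTestFunction Ω ψ) : ContDiff ℝ 1 ψ :=
  h.1.of_le (by exact_mod_cast le_top)

theorem ofReal_le_totalVariation {Ω : Set (Euc d)} (v : Euc d → ℝ) {Ψ : Euc d → Euc d}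
    (h : IsTestFunction Ω Ψ) (h1 : ∀ x, ‖Ψ x‖ ≤ 1) :
    ENNReal.ofReal (∫ x in Ω, v x * divergence Ψ x) ≤ totalVariation Ω v :=
  le_iSup₂_of_le Ψ ⟨h, h1⟩ le_rfl

/-- The estimate for a mollified function and a smooth `1`-Lipschitz `T`: since `|T'| ≤ 1`, the
field `ρ ⋆ (T'(ρ ⋆ v) Ψ)` is admissible in the definition of the total variation of `v`. -/
theorem ofReal_integral_comp_mollify_le {Ω : Set (Euc d)} (hΩ : MeasurableSet Ω) {v : Euc d → ℝ}
    (hv : IntegrableOn v Ω) {T : ℝ → ℝ} (hT : ContDiff ℝ ((⊤ : ℕ∞) : WithTop ℕ∞) T)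
    (hT1 : LipschitzWith 1 T)
    {Ψ : Euc d → Euc d} (hΨ : IsTestFunction Ω Ψ) (hΨ1 : ∀ x, ‖Ψ x‖ ≤ 1)
    (ρ : ContDiffBump (0 : Euc d)) (hρ : Metric.cthickening ρ.rOut (tsupport Ψ) ⊆ Ω) :
    ENNReal.ofReal (∫ x in Ω, T (mollify ρ (Ω.indicator v) x) * divergence Ψ x) ≤
      totalVariation Ω v := by
  have hv' : Integrable (Ω.indicator v) := (integrable_indicator_iff hΩ).2 hv
  set w := mollify ρ (Ω.indicator v) with hw_def
  have hw : ContDiff ℝ ((⊤ : ℕ∞) : WithTop ℕ∞) w := contDiff_mollify ρ hv'.locallyIntegrable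
  set Ψ' : Euc d → Euc d := fun y => deriv T (w y) • Ψ y with hΨ'_def
  have hT' : ContDiff ℝ ((⊤ : ℕ∞) : WithTop ℕ∞) (deriv T) :=
    (contDiff_infty_iff_deriv.1 hT).2
  have hΨ' : ContDiff ℝ ((⊤ : ℕ∞) : WithTop ℕ∞) Ψ' := (hT'.comp hw).smul hΨ.1
  have hc' : HasCompactSupport Ψ' := hΨ.2.1.fun_smul
  have hΨ'1 : ∀ x, ‖Ψ' x‖ ≤ 1 := by
    intro x
    rw [hΨ'_def, norm_smul]
    have h1 : ‖deriv T (w x)‖ ≤ 1 := by simpa using norm_deriv_le_of_lipschitz hT1 (x₀ := w x)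
    exact mul_le_one₀ h1 (norm_nonneg _) (hΨ1 x)
  have hsub : tsupport Ψ' ⊆ tsupport Ψ := closure_mono fun x hx h0 => hx (by
    simp only [hΨ'_def, h0, smul_zero])
  have hC1 : ContDiff ℝ 1 Ψ' := hΨ'.of_le (by exact_mod_cast le_top)
  have htest : IsTestFunction Ω (mollify ρ Ψ') :=
    ⟨contDiff_mollify ρ (hΨ'.continuous.locallyIntegrable), hc'.mollify ρ,
      (tsupport_mollify_subset ρ Ψ').trans
        ((Metric.cthickening_subset_of_subset _ hsub).trans hρ)⟩
  have key : ∫ x in Ω, T (w x) * divergence Ψ x =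
      ∫ x in Ω, v x * divergence (mollify ρ Ψ') x := by
    rw [setIntegral_mul_divergence_eq _ hΨ.2.2,
      integral_comp_mul_divergence (contDiff_infty.1 hT 2)
        (hw.of_le (by exact_mod_cast le_top)) hΨ.contDiff_one hΨ.2.1,
      integral_mollify_mul ρ hv' (integrable_divergence hC1 hc'),
      divergence_mollify ρ hC1 hc', ← integral_indicator hΩ]
    congr 1; ext x
    by_cases hx : x ∈ Ω <;> simp [hx, hΨ'_def]
  rw [key]
  exact ofReal_le_totalVariation v htest (norm_mollify_le ρ hΨ'1)

/-- Composition with a bounded `1`-Lipschitz function does not increase the total variation. -/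
theorem totalVariation_comp_le {Ω : Set (Euc d)} (hΩ : IsOpen Ω) {v : Euc d → ℝ}
    (hv : IntegrableOn v Ω) {T : ℝ → ℝ} (hT : LipschitzWith 1 T) {C : ℝ} (hC : ∀ t, ‖T t‖ ≤ C) :
    totalVariation Ω (fun x => T (v x)) ≤ totalVariation Ω v := by
  refine iSup₂_le fun Ψ hΨ => ?_
  obtain ⟨hΨ, hΨ1⟩ := hΨ
  obtain ⟨r, hr, hrΩ⟩ := hΨ.2.1.isCompact.exists_cthickening_subset_open hΩ hΨ.2.2
  have hrk : ∀ k : ℕ, 0 < r / (k + 1) := fun k => by positivity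
  have hr0 : Tendsto (fun k : ℕ => r / ((k : ℝ) + 1)) atTop (𝓝 0) := by
    simpa [div_eq_mul_inv] using tendsto_one_div_add_atTop_nhds_zero_nat.const_mul r
  -- Radii below `r` keep the mollified test fields supported in `Ω`; the constant ratio of outer to
  -- inner radius gives almost everywhere convergence of the mollifications.
  let ρ : ℕ → ContDiffBump (0 : Euc d) := fun k =>
    ⟨r / (k + 1) / 2, r / (k + 1), half_pos (hrk k), half_lt_self (hrk k)⟩
  let τ : ℕ → ContDiffBump (0 : ℝ) := fun k =>
    ⟨r / (k + 1) / 2, r / (k + 1), half_pos (hrk k), half_lt_self (hrk k)⟩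
  have hv' : Integrable (Ω.indicator v) := (integrable_indicator_iff hΩ.measurableSet).2 hv
  have hdiv := integrable_divergence hΨ.contDiff_one hΨ.2.1
  have hlim : Tendsto (fun k => ∫ x in Ω,
      mollify (τ k) T (mollify (ρ k) (Ω.indicator v) x) * divergence Ψ x) atTop
      (𝓝 (∫ x in Ω, T (v x) * divergence Ψ x)) := by
    refine tendsto_integral_of_dominated_convergence (fun x => C * ‖divergence Ψ x‖) ?_
      (hdiv.norm.const_mul C).integrableOn ?_ ?_
    · intro k
      refine Continuous.aestronglyMeasurable ?_
      exact ((hT.mollify (τ k)).continuous.comp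
        (contDiff_mollify (k := 0) (ρ k) hv'.locallyIntegrable).continuous).mul
        (continuous_divergence hΨ.contDiff_one)
    · intro k
      refine Eventually.of_forall fun x => ?_
      rw [norm_mul]
      exact mul_le_mul_of_nonneg_right (norm_mollify_le _ hC _) (norm_nonneg _)
    · have hae : ∀ᵐ x, Tendsto (fun k => mollify (ρ k) (Ω.indicator v) x) atTop
          (𝓝 (Ω.indicator v x)) :=
        ContDiffBump.ae_convolution_tendsto_right_of_locallyIntegrable (K := 2) hr0
          (Eventually.of_forall fun k => by simp only [ρ]; linarith) hv'.locallyIntegrable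
      filter_upwards [ae_restrict_of_ae hae, ae_restrict_mem hΩ.measurableSet] with x hx hxΩ
      rw [indicator_of_mem hxΩ] at hx
      refine Tendsto.mul_const _ ?_
      have h1 : Tendsto (fun k => T (mollify (ρ k) (Ω.indicator v) x)) atTop (𝓝 (T (v x))) :=
        (hT.continuous.tendsto _).comp hx
      refine tendsto_of_tendsto_of_dist h1 ?_
      refine squeeze_zero (fun _ => dist_nonneg) (fun k => ?_) hr0
      rw [dist_comm]
      exact dist_mollify_le_of_lipschitz (τ k) hT _
  refine le_of_tendsto' (ENNReal.tendsto_ofReal hlim) fun k => ?_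
  refine ofReal_integral_comp_mollify_le hΩ.measurableSet hv
    (contDiff_mollify (τ k) hT.continuous.locallyIntegrable) (hT.mollify (τ k)) hΨ hΨ1 (ρ k)
    ((Metric.cthickening_mono ?_ _).trans hrΩ)
  exact div_le_self hr.le (by linarith [(Nat.cast_nonneg k : (0 : ℝ) ≤ k)])

/-! ### Operations in the space of functions of bounded variation -/

theorem divergence_neg (Ψ : Euc d → Euc d) (x : Euc d) :
    divergence (fun y => -Ψ y) x = -divergence Ψ x := by
  simp only [divergence_eq_traceCLM, fderiv_fun_neg, map_neg]

theorem IsTestFunction.neg {Ω : Set (Euc d)} {Ψ : Euc d → Euc d} (h : IsTestFunction Ω Ψ) :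
    IsTestFunction Ω fun x => -Ψ x := by
  have hs : tsupport (fun x => -Ψ x) ⊆ tsupport Ψ :=
    closure_mono fun x hx h0 => hx (by simp only [h0, neg_zero])
  exact ⟨h.1.neg, h.2.1.of_isClosed_subset (isClosed_tsupport _) hs, hs.trans h.2.2⟩

theorem integrableOn_mul_divergence {Ω : Set (Euc d)} {v : Euc d → ℝ} (hv : IntegrableOn v Ω)
    {Ψ : Euc d → Euc d} (h : IsTestFunction Ω Ψ) :
    IntegrableOn (fun x => v x * divergence Ψ x) Ω := by
  have hcont := continuous_divergence h.contDiff_one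
  obtain ⟨C, hC⟩ := hcont.bounded_above_of_compact_support (hasCompactSupport_divergence h.2.1)
  exact hv.mul_bdd hcont.aestronglyMeasurable (Eventually.of_forall hC)

theorem totalVariation_add_le {Ω : Set (Euc d)} {v w : Euc d → ℝ} (hv : IntegrableOn v Ω)
    (hw : IntegrableOn w Ω) :
    totalVariation Ω (fun x => v x + w x) ≤ totalVariation Ω v + totalVariation Ω w := by
  refine iSup₂_le fun Ψ hΨ => ?_
  simp_rw [add_mul]
  rw [integral_add (integrableOn_mul_divergence hv hΨ.1) (integrableOn_mul_divergence hw hΨ.1)]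
  exact ENNReal.ofReal_add_le.trans
    (add_le_add (ofReal_le_totalVariation v hΨ.1 hΨ.2) (ofReal_le_totalVariation w hΨ.1 hΨ.2))

theorem totalVariation_const_mul_le {Ω : Set (Euc d)} (c : ℝ) (v : Euc d → ℝ) :
    totalVariation Ω (fun x => c * v x) ≤ ENNReal.ofReal |c| * totalVariation Ω v := by
  refine iSup₂_le fun Ψ hΨ => ?_
  simp_rw [mul_assoc]
  rw [integral_const_mul]
  rcases le_total 0 c with hc | hc
  · rw [ENNReal.ofReal_mul hc, abs_of_nonneg hc]
    exact mul_le_mul_right (ofReal_le_totalVariation v hΨ.1 hΨ.2) _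
  -- For `c ≤ 0` the admissible field is `-Ψ`.
  · have h := ofReal_le_totalVariation v hΨ.1.neg (by simpa using hΨ.2)
    simp_rw [divergence_neg, mul_neg] at h
    rw [integral_neg] at h
    rw [← neg_mul_neg, ENNReal.ofReal_mul (neg_nonneg.2 hc), abs_of_nonpos hc]
    exact mul_le_mul_right h _

theorem MemBV.integrableOn {Ω : Set (Euc d)} {v : Euc d → ℝ} (hv : MemBV Ω v) :
    IntegrableOn v Ω :=
  memLp_one_iff_integrable.1 hv.1

theorem MemBV.add {Ω : Set (Euc d)} {v w : Euc d → ℝ} (hv : MemBV Ω v) (hw : MemBV Ω w) :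
    MemBV Ω (fun x => v x + w x) :=
  ⟨hv.1.add hw.1, (totalVariation_add_le hv.integrableOn hw.integrableOn).trans_lt
    (ENNReal.add_lt_top.2 ⟨hv.2, hw.2⟩)⟩

theorem MemBV.const_mul {Ω : Set (Euc d)} {v : Euc d → ℝ} (hv : MemBV Ω v) (c : ℝ) :
    MemBV Ω (fun x => c * v x) :=
  ⟨hv.1.const_mul c, (totalVariation_const_mul_le c v).trans_lt
    (ENNReal.mul_lt_top ENNReal.ofReal_lt_top hv.2)⟩

theorem MemBV.sub {Ω : Set (Euc d)} {v w : Euc d → ℝ} (hv : MemBV Ω v) (hw : MemBV Ω w) :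
    MemBV Ω (fun x => v x - w x) := by
  simpa [sub_eq_add_neg] using hv.add (hw.const_mul (-1))

theorem MemBV.bvNorm_lt_top {Ω : Set (Euc d)} {v : Euc d → ℝ} (hv : MemBV Ω v) :
    bvNorm Ω v < ⊤ :=
  ENNReal.add_lt_top.2 ⟨hv.1.2, hv.2⟩

theorem bvNorm_const_mul_le {Ω : Set (Euc d)} (c : ℝ) (v : Euc d → ℝ) :
    bvNorm Ω (fun x => c * v x) ≤ ENNReal.ofReal |c| * bvNorm Ω v := by
  unfold bvNorm
  rw [mul_add]
  refine add_le_add ?_ (totalVariation_const_mul_le c v)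
  have := eLpNorm_const_smul_le (c := c) (f := v) (p := 1) (μ := volume.restrict Ω)
  rwa [Real.enorm_eq_ofReal_abs] at this

/-! ### Truncation -/

/-- The projection of `t` onto `[a, b]`. -/
def clamp (a b t : ℝ) : ℝ := max a (min b t)

section clamp

variable {a b t : ℝ}

theorem clamp_of_le (h : t ≤ a) (hab : a ≤ b) : clamp a b t = a := by
  rw [clamp, min_eq_right (h.trans hab), max_eq_left h]

theorem clamp_of_mem (h₁ : a ≤ t) (h₂ : t ≤ b) : clamp a b t = t := by
  rw [clamp, min_eq_right h₂, max_eq_right h₁]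

theorem clamp_of_ge (h : b ≤ t) (hab : a ≤ b) : clamp a b t = b := by
  rw [clamp, min_eq_left h, max_eq_right hab]

theorem le_clamp : a ≤ clamp a b t := le_max_left _ _

theorem clamp_le (hab : a ≤ b) : clamp a b t ≤ b := max_le hab (min_le_left _ _)

theorem lipschitzWith_clamp (a b : ℝ) : LipschitzWith 1 (clamp a b) :=
  (LipschitzWith.id.const_min b).const_max a

theorem norm_clamp_le (hab : a ≤ b) (t : ℝ) : ‖clamp a b t‖ ≤ max |a| |b| :=
  abs_le_max_abs_abs le_clamp (clamp_le hab)

end clamp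

theorem totalVariation_clamp_le {Ω : Set (Euc d)} (hΩ : IsOpen Ω) {v : Euc d → ℝ}
    (hv : IntegrableOn v Ω) {a b : ℝ} (hab : a ≤ b) :
    totalVariation Ω (fun x => clamp a b (v x)) ≤ totalVariation Ω v :=
  totalVariation_comp_le hΩ hv (lipschitzWith_clamp a b) (norm_clamp_le hab)

theorem MemBV.clamp {Ω : Set (Euc d)} (hΩ : IsOpen Ω) (hb : Bornology.IsBounded Ω)
    {v : Euc d → ℝ} (hv : MemBV Ω v) {a b : ℝ} (hab : a ≤ b) :
    MemBV Ω (fun x => clamp a b (v x)) := by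
  have : IsFiniteMeasure (volume.restrict Ω) := ⟨by simpa using hb.measure_lt_top⟩
  exact ⟨MemLp.of_bound
    ((lipschitzWith_clamp a b).continuous.comp_aestronglyMeasurable hv.1.1) (max |a| |b|)
    (Eventually.of_forall fun x => norm_clamp_le hab _),
    (totalVariation_clamp_le hΩ hv.integrableOn hab).trans_lt hv.2⟩

/-- The total variation is convex along the segment from `v` to its truncation, on which it
therefore stays below its value at `v`. -/
theorem totalVariation_shrink_le {Ω : Set (Euc d)} (hΩ : IsOpen Ω) (hb : Bornology.IsBounded Ω)
    {v : Euc d → ℝ} (hv : MemBV Ω v) {a b s : ℝ} (hab : a ≤ b) (hs₀ : 0 ≤ s) (hs₁ : s ≤ 1) :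
    totalVariation Ω (fun x => v x + s * (clamp a b (v x) - v x)) ≤ totalVariation Ω v := by
  have h : (fun x => v x + s * (clamp a b (v x) - v x)) =
      fun x => (1 - s) * v x + s * clamp a b (v x) := by ext x; ring
  have hc := hv.clamp hΩ hb hab
  rw [h]
  calc _ ≤ _ := totalVariation_add_le (hv.const_mul (1 - s)).integrableOn
        (hc.const_mul s).integrableOn
    _ ≤ ENNReal.ofReal (1 - s) * totalVariation Ω v + ENNReal.ofReal s * totalVariation Ω v := by
        refine add_le_add ((totalVariation_const_mul_le _ _).trans ?_)
          ((totalVariation_const_mul_le _ _).trans ?_)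
        · rw [abs_of_nonneg (sub_nonneg.2 hs₁)]
        · rw [abs_of_nonneg hs₀]
          exact mul_le_mul_right (totalVariation_clamp_le hΩ hv.integrableOn hab) _
    _ = totalVariation Ω v := by
        rw [← add_mul, ← ENNReal.ofReal_add (sub_nonneg.2 hs₁) hs₀]; simp

/-! ### Short steps in `BV`, and the coefficient of the state equation -/

/-- Short steps along a segment in `BV` stay in any given ball. -/
theorem exists_bvNorm_const_mul_lt {Ω : Set (Euc d)} {v : Euc d → ℝ} (hv : MemBV Ω v) {δ : ℝ}
    (hδ : 0 < δ) :
    ∃ s : ℝ, 0 < s ∧ s < 1 ∧ bvNorm Ω (fun x => s * v x) < ENNReal.ofReal δ := by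
  set B := (bvNorm Ω v).toReal
  have hB : 0 ≤ B := ENNReal.toReal_nonneg
  have hs : 0 < min (1 / 2) (δ / (2 * (B + 1))) := by positivity
  refine ⟨_, hs, (min_le_left _ _).trans_lt (by norm_num), ?_⟩
  refine (bvNorm_const_mul_le _ v).trans_lt ?_
  rw [abs_of_pos hs, ← ENNReal.ofReal_toReal hv.bvNorm_lt_top.ne, ← ENNReal.ofReal_mul hs.le]
  refine (ENNReal.ofReal_lt_ofReal_iff hδ).2 ?_
  calc _ ≤ δ / (2 * (B + 1)) * B := mul_le_mul_of_nonneg_right (min_le_right _ _) hB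
    _ < δ := by
      rw [div_mul_eq_mul_div, div_lt_iff₀ (by positivity)]
      nlinarith

theorem IsWeakSolution.congr_coeff {Ω : Set (Euc d)} {w w' f y : Euc d → ℝ}
    (h : IsWeakSolution Ω w f y) (hw : w =ᵐ[volume.restrict Ω] w') : IsWeakSolution Ω w' f y := by
  obtain ⟨V, hV, hsol⟩ := h
  refine ⟨V, hV, fun ψ hψ => ?_⟩
  rw [← hsol ψ hψ]
  refine integral_congr_ae ?_
  filter_upwards [hw] with x hx
  rw [hx]

namespace MultibangData

variable {n : ℕ} (D : MultibangData n)

/-! ### The integrand `g` and the projection `φ_ε` -/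

theorem um_pos : 0 < D.um := by
  have h := D.val_strictMono (mem_Icc.2 ⟨le_rfl, one_le_two.trans D.two_le_m⟩)
    (mem_Icc.2 ⟨one_le_two.trans D.two_le_m, le_rfl⟩) (one_lt_two.trans_le D.two_le_m)
  rwa [D.val_one] at h

theorem g_of_nonpos {t : ℝ} (ht : t ≤ 0) : D.g t = -D.um * t := by
  rw [g, D.val_one, if_pos ht]

theorem g_of_um_lt {t : ℝ} (ht : D.um < t) : D.g t = D.um * t - 1 / 2 * D.um ^ 2 := by
  rw [g, D.val_one, if_neg (D.um_pos.trans ht).not_ge, if_pos ht]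

theorem g_um : D.g D.um = 1 / 2 * D.um ^ 2 := by
  have hm := D.two_le_m
  have hmono := D.val_strictMono
  -- Only the last interval `(u_{m-1}, u_m]` contains `u_m`.
  rw [g, D.val_one, if_neg D.um_pos.not_ge, if_neg (lt_irrefl _),
    Finset.sum_eq_single (D.m - 1)]
  · have h1 : D.m - 1 + 1 = D.m := by omega
    rw [h1, indicator_of_mem]
    · rw [um]; ring
    · exact ⟨hmono ⟨by omega, by omega⟩ ⟨by omega, le_rfl⟩ (by omega), le_rfl⟩
  · intro i hi hne
    rw [Finset.mem_Ico] at hi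
    refine indicator_of_notMem (fun h => ?_) _
    exact (hmono ⟨by omega, by omega⟩ ⟨by omega, le_rfl⟩ (by omega : i + 1 < D.m)).not_ge h.2
  · intro h
    exact absurd (Finset.mem_Ico.2 ⟨by omega, by omega⟩) h

theorem measurable_g : Measurable D.g := by
  unfold g
  refine Measurable.ite measurableSet_Iic (by fun_prop)
    (Measurable.ite measurableSet_Ioi (by fun_prop) ?_)
  exact Finset.measurable_fun_sum _ fun i _ =>
    Measurable.indicator (by fun_prop) measurableSet_Ioc

/-- `g` grows at most linearly, so `G(u)` is a convergent integral for every `u ∈ L¹(Ω)`. -/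
theorem exists_norm_g_le : ∃ A B : ℝ, ∀ t, ‖D.g t‖ ≤ A * ‖t‖ + B := by
  set A := ∑ i ∈ Finset.Ico 1 D.m, |1 / 2 * (D.val i + D.val (i + 1))| with hA
  set B := ∑ i ∈ Finset.Ico 1 D.m, |1 / 2 * (D.val i * D.val (i + 1))| with hB
  have hA0 : 0 ≤ A := Finset.sum_nonneg fun _ _ => abs_nonneg _
  have hB0 : 0 ≤ B := Finset.sum_nonneg fun _ _ => abs_nonneg _
  have hu := D.um_pos
  refine ⟨A + D.um, B + 1 / 2 * D.um ^ 2, fun t => ?_⟩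
  have ht := norm_nonneg t
  have e1 : ‖D.um * t‖ = D.um * ‖t‖ := by rw [norm_mul, Real.norm_of_nonneg hu.le]
  have e2 : ‖1 / 2 * D.um ^ 2‖ = 1 / 2 * D.um ^ 2 := Real.norm_of_nonneg (by positivity)
  have p1 : 0 ≤ A * ‖t‖ := by positivity
  have p2 : 0 ≤ D.um * ‖t‖ := by positivity
  have p3 : 0 ≤ 1 / 2 * D.um ^ 2 := by positivity
  unfold g
  split_ifs
  · rw [neg_mul, norm_neg, e1]; linarith
  · have := norm_sub_le (D.um * t) (1 / 2 * D.um ^ 2)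
    rw [e1, e2] at this
    linarith
  · refine (norm_sum_le _ _).trans (le_trans (Finset.sum_le_sum (g := fun i =>
      |1 / 2 * (D.val i + D.val (i + 1))| * ‖t‖ + |1 / 2 * (D.val i * D.val (i + 1))|) ?_) ?_)
    · intro i _
      refine (norm_indicator_le_norm_self _ _).trans ?_
      rw [mul_sub, ← mul_assoc]
      refine (norm_sub_le _ _).trans ?_
      rw [norm_mul]; rfl
    · rw [Finset.sum_add_distrib, ← Finset.sum_mul, ← hA, ← hB]
      linarith

theorem integrableOn_g_comp {u : Euc (n + 1) → ℝ} (hu : IntegrableOn u D.Ω) :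
    IntegrableOn (fun x => D.g (u x)) D.Ω := by
  obtain ⟨A, B, h⟩ := D.exists_norm_g_le
  have : IsFiniteMeasure (volume.restrict D.Ω) := ⟨by simpa using D.isBounded.measure_lt_top⟩
  refine Integrable.mono' ((hu.norm.const_mul A).add (integrable_const B)) ?_
    (Eventually.of_forall fun x => h _)
  exact (D.measurable_g.comp_aemeasurable hu.aestronglyMeasurable.aemeasurable).aestronglyMeasurable

theorem g_clamp_le (t : ℝ) : D.g (clamp 0 D.um t) ≤ D.g t := by
  have hu := D.um_pos
  rcases le_or_gt t 0 with h | h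
  · rw [clamp_of_le h hu.le, D.g_of_nonpos h, D.g_of_nonpos le_rfl]
    nlinarith
  · rcases le_or_gt t D.um with h' | h'
    · rw [clamp_of_mem h.le h']
    · rw [clamp_of_ge h'.le hu.le, D.g_um, D.g_of_um_lt h']
      nlinarith

/-- Moving a value outside `[-ε, u_m + ε]` towards this interval decreases `g` strictly. For
`s < 1` the moved value stays outside, where `g` is affine. -/
theorem g_shrink_lt {ε s t : ℝ} (hε : 0 ≤ ε) (hs₀ : 0 < s) (hs₁ : s < 1)
    (ht : clamp (-ε) (D.um + ε) t ≠ t) :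
    D.g (t + s * (clamp (-ε) (D.um + ε) t - t)) < D.g t := by
  have hu := D.um_pos
  have hab : -ε ≤ D.um + ε := by linarith
  rcases lt_or_ge t (-ε) with h | h
  · rw [clamp_of_le h.le hab, D.g_of_nonpos (by nlinarith), D.g_of_nonpos (by linarith)]
    nlinarith [mul_pos hu (mul_pos hs₀ (sub_pos.2 h))]
  · rcases le_or_gt t (D.um + ε) with h' | h'
    · exact absurd (clamp_of_mem h h') ht
    · rw [clamp_of_ge h'.le hab, D.g_of_um_lt (by nlinarith), D.g_of_um_lt (by linarith)]
      nlinarith [mul_pos hu (mul_pos hs₀ (sub_pos.2 h'))]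

theorem g_shrink_le {ε s t : ℝ} (hε : 0 ≤ ε) (hs₀ : 0 < s) (hs₁ : s < 1) :
    D.g (t + s * (clamp (-ε) (D.um + ε) t - t)) ≤ D.g t := by
  by_cases ht : clamp (-ε) (D.um + ε) t = t
  · simp [ht]
  · exact (D.g_shrink_lt hε hs₀ hs₁ ht).le

theorem phi_of_le {ε t : ℝ} (h : t ≤ -ε) : D.phi ε t = D.umin + -ε := by
  rw [phi, if_pos h]

theorem phi_of_gt {ε t : ℝ} (hε : 0 ≤ ε) (h : D.um + ε < t) :
    D.phi ε t = D.umin + (D.um + ε) := by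
  have hu := D.um_pos
  rw [phi, if_neg (by linarith), if_neg (by linarith), if_neg (by linarith), if_neg h.not_ge]

/-- `φ_ε` is constant on either side of `[-ε, u_m + ε]`. -/
theorem phi_shrink {ε s t : ℝ} (hε : 0 ≤ ε) (hs₁ : s < 1) :
    D.phi ε (t + s * (clamp (-ε) (D.um + ε) t - t)) = D.phi ε t := by
  have hu := D.um_pos
  have hab : -ε ≤ D.um + ε := by linarith
  rcases lt_or_ge t (-ε) with h | h
  · rw [clamp_of_le h.le hab, D.phi_of_le h.le, D.phi_of_le (by nlinarith)]
  · rcases le_or_gt t (D.um + ε) with h' | h'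
    · rw [clamp_of_mem h h', sub_self, mul_zero, add_zero]
    · rw [clamp_of_ge h'.le hab, D.phi_of_gt hε h', D.phi_of_gt hε (by nlinarith)]

/-- For `ε = 0` the cubic branches, with their divisions by zero, are void. -/
theorem phi_zero (t : ℝ) : D.phi 0 t = clamp 0 D.um t + D.umin := by
  have hu := D.um_pos
  rcases le_or_gt t 0 with h | h
  · rw [D.phi_of_le (by simpa using h), clamp_of_le h hu.le]; ring
  · rcases le_or_gt t D.um with h' | h'
    · rw [clamp_of_mem h.le h', phi, if_neg (by simpa using h), if_neg h.not_ge, if_pos h',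
        add_comm]
    · rw [D.phi_of_gt le_rfl (by simpa using h'), clamp_of_ge h'.le hu.le]; ring

/-! ### Comparison with truncated controls -/

/-- Local solutions of (P) take values in `[-ε, u_m + ε]`: otherwise a short step towards the
truncation keeps the state, does not increase the total variation, and decreases `G`. -/
theorem ae_mem_of_isLocalSolution {ε : ℝ} (hε : 0 ≤ ε) {u : Euc (n + 1) → ℝ}
    (hu : D.IsLocalSolution (D.FeasibleP ε) u) :
    ∀ᵐ x ∂(volume.restrict D.Ω), -ε ≤ u x ∧ u x ≤ D.um + ε := by
  obtain ⟨y, ⟨hBV, hsol⟩, δ, hδ, hopt⟩ := hu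
  have hab : -ε ≤ D.um + ε := by linarith [D.um_pos]
  have hc := hBV.clamp D.isOpen D.isBounded hab
  obtain ⟨s, hs₀, hs₁, hs⟩ := exists_bvNorm_const_mul_lt (hc.sub hBV) hδ
  set v : Euc (n + 1) → ℝ := fun x => u x + s * (clamp (-ε) (D.um + ε) (u x) - u x) with hv
  have hvBV : MemBV D.Ω v := hBV.add ((hc.sub hBV).const_mul s)
  have hfeas : D.FeasibleP ε v y := by
    refine ⟨hvBV, ?_⟩
    simp only [hv, D.phi_shrink hε hs₁]
    exact hsol
  have hcost := hopt v y hfeas (by simpa [hv] using hs)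
  have hTV : (totalVariation D.Ω v).toReal ≤ (totalVariation D.Ω u).toReal :=
    ENNReal.toReal_mono hBV.2.ne
      (totalVariation_shrink_le D.isOpen D.isBounded hBV hab hs₀.le hs₁.le)
  have hG : D.G u ≤ D.G v := by
    have h1 := mul_le_mul_of_nonneg_left hTV D.β_pos.le
    unfold cost at hcost
    exact le_of_mul_le_mul_left (by linarith) D.α_pos
  have hiu := D.integrableOn_g_comp hBV.integrableOn
  have hiv := D.integrableOn_g_comp hvBV.integrableOn
  have hnonneg : 0 ≤ fun x => D.g (u x) - D.g (v x) := fun x =>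
    sub_nonneg.2 (D.g_shrink_le hε hs₀ hs₁)
  have hzero : ∫ x in D.Ω, (D.g (u x) - D.g (v x)) = 0 := by
    refine le_antisymm ?_ (integral_nonneg hnonneg)
    rw [integral_sub hiu hiv]
    exact sub_nonpos.2 hG
  filter_upwards [(integral_eq_zero_iff_of_nonneg hnonneg (hiu.sub hiv)).1 hzero] with x hx
  by_contra hne
  refine (sub_pos.2 (D.g_shrink_lt (t := u x) hε hs₀ hs₁ fun h => hne ?_)).ne' hx
  rw [← h]
  exact ⟨le_clamp, clamp_le hab⟩

theorem FeasibleStar.feasibleP {D : MultibangData n} {u y : Euc (n + 1) → ℝ}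
    (h : D.FeasibleStar u y) : D.FeasibleP 0 u y := by
  refine ⟨h.1, h.2.2.congr_coeff ?_⟩
  filter_upwards [h.2.1] with x hx
  have h1 : D.um = D.umax - D.umin := D.val_m
  rw [D.phi_zero, clamp_of_mem (by linarith [hx.1]) (by linarith [hx.2])]

theorem FeasibleP.feasibleStar {D : MultibangData n} {u y : Euc (n + 1) → ℝ}
    (h : D.FeasibleP 0 u y) (hu : ∀ᵐ x ∂(volume.restrict D.Ω), 0 ≤ u x ∧ u x ≤ D.um) :
    D.FeasibleStar u y := by
  have h1 : D.um = D.umax - D.umin := D.val_m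
  refine ⟨h.1, ?_, h.2.congr_coeff ?_⟩
  · filter_upwards [hu] with x hx
    constructor <;> linarith [hx.1, hx.2]
  · filter_upwards [hu] with x hx
    rw [D.phi_zero, clamp_of_mem hx.1 hx.2]

theorem FeasibleP.clamp {D : MultibangData n} {u y : Euc (n + 1) → ℝ}
    (h : D.FeasibleP 0 u y) : D.FeasibleStar (fun x => clamp 0 D.um (u x)) y := by
  have hu := D.um_pos
  refine FeasibleP.feasibleStar ⟨h.1.clamp D.isOpen D.isBounded hu.le, ?_⟩
    (Eventually.of_forall fun x => ⟨le_clamp, clamp_le hu.le⟩)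
  have he : ∀ x, D.phi 0 (_root_.clamp 0 D.um (u x)) = D.phi 0 (u x) := fun x => by
    rw [D.phi_zero, D.phi_zero, clamp_of_mem le_clamp (clamp_le hu.le)]
  simp only [he]
  exact h.2

theorem cost_clamp_le {u : Euc (n + 1) → ℝ} (hu : MemBV D.Ω u) (y : Euc (n + 1) → ℝ) :
    D.cost (fun x => clamp 0 D.um (u x)) y ≤ D.cost u y := by
  have h0 := D.um_pos.le
  have hG : D.G (fun x => clamp 0 D.um (u x)) ≤ D.G u :=
    integral_mono
      (D.integrableOn_g_comp (hu.clamp D.isOpen D.isBounded h0).integrableOn)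
      (D.integrableOn_g_comp hu.integrableOn) fun x => D.g_clamp_le (u x)
  have hTV : (totalVariation D.Ω fun x => clamp 0 D.um (u x)).toReal ≤
      (totalVariation D.Ω u).toReal :=
    ENNReal.toReal_mono hu.2.ne (totalVariation_clamp_le D.isOpen hu.integrableOn h0)
  have h1 := mul_le_mul_of_nonneg_left hG D.α_pos.le
  have h2 := mul_le_mul_of_nonneg_left hTV D.β_pos.le
  unfold cost
  linarith

variable {D}

theorem IsGlobalSolution.isLocalSolution
    {Feasible : (Euc (n + 1) → ℝ) → (Euc (n + 1) → ℝ) → Prop} {u : Euc (n + 1) → ℝ}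
    (h : D.IsGlobalSolution Feasible u) : D.IsLocalSolution Feasible u := by
  obtain ⟨y, hy, hopt⟩ := h
  exact ⟨y, hy, 1, one_pos, fun v w hv _ => hopt v w hv⟩

theorem ae_mem_of_isLocalSolution_zero {u : Euc (n + 1) → ℝ}
    (hu : D.IsLocalSolution (D.FeasibleP 0) u) :
    ∀ᵐ x ∂(volume.restrict D.Ω), 0 ≤ u x ∧ u x ≤ D.um := by
  simpa using D.ae_mem_of_isLocalSolution le_rfl hu

end MultibangData

end

theorem mainTheorem4 (n : ℕ) (D : MultibangData n) :
    (∀ ε : ℝ, 0 ≤ ε → ε < D.umin → ∀ u : Euc (n + 1) → ℝ,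
      D.IsLocalSolution (D.FeasibleP ε) u →
        (fun x => u x + D.umin) ∈ D.U ε ∧
        (∀ᵐ x ∂(volume.restrict D.Ω), -ε ≤ u x ∧ u x ≤ D.um + ε) ∧
        MemLp u ∞ (volume.restrict D.Ω)) ∧
    (∀ u : Euc (n + 1) → ℝ,
      D.IsLocalSolution (D.FeasibleP 0) u → D.IsLocalSolution D.FeasibleStar u) ∧
    (∀ u : Euc (n + 1) → ℝ,
      D.IsGlobalSolution (D.FeasibleP 0) u ↔ D.IsGlobalSolution D.FeasibleStar u) := by
  refine ⟨fun ε hε hεu u hu => ?_, fun u hu => ?_, fun u => ⟨fun hu => ?_, fun hu => ?_⟩⟩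
  · have hae := D.ae_mem_of_isLocalSolution hε hu
    obtain ⟨y, ⟨hBV, -⟩, -⟩ := hu
    have : IsFiniteMeasure (volume.restrict D.Ω) := ⟨by simpa using D.isBounded.measure_lt_top⟩
    have hLp : MemLp u ∞ (volume.restrict D.Ω) := by
      refine memLp_top_of_bound hBV.1.1 (max |-ε| |D.um + ε|) ?_
      filter_upwards [hae] with x hx
      exact abs_le_max_abs_abs hx.1 hx.2
    have hum : D.um = D.umax - D.umin := D.val_m
    refine ⟨⟨hLp.add (memLp_const _), sub_pos.2 hεu, ?_⟩, hae, hLp⟩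
    filter_upwards [hae] with x hx
    constructor <;> linarith [hx.1, hx.2]
  · have hae := MultibangData.ae_mem_of_isLocalSolution_zero hu
    obtain ⟨y, hy, δ, hδ, hopt⟩ := hu
    exact ⟨y, hy.feasibleStar hae, δ, hδ, fun v w hv => hopt v w hv.feasibleP⟩
  · have hae := MultibangData.ae_mem_of_isLocalSolution_zero hu.isLocalSolution
    obtain ⟨y, hy, hopt⟩ := hu
    exact ⟨y, hy.feasibleStar hae, fun v w hv => hopt v w hv.feasibleP⟩
  · obtain ⟨y, hy, hopt⟩ := hu
    exact ⟨y, hy.feasibleP, fun v w hv =>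
      (hopt _ w hv.clamp).trans (D.cost_clamp_le hv.1 w)⟩
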